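/- **Theorem (feedback capacity and time-invariance of the optimal distributions for the BSSC).** Let $\alpha,\beta\in[0,1]$ with $\alpha+\beta\neq1$. The binary state symmetric channel BSSC$(\alpha,\beta)$ has inputs $A_i\in\{0,1\}$ and outputs $B_i\in\{0,1\}$, $i=0,1,\dots$, with initial state $B_{-1}\in\{0,1\}$ of arbitrary law $\rho$ (for instance a fixed value $b_{-1}$), and the output $B_i$ given the past depends only on $(A_i,B_{i-1})$, with $$P(b_i=0\mid a_i,b_{i-1})=\alpha,\ \beta,\ 1-\beta,\ 1-\alpha\quad\text{for }(a_i,b_{i-1})=(0,0),\ (0,1),\ (1,0),\ (1,1).$$ All logarithms are to base $2$ and $H(p)=-p\log p-(1-p)\log(1-p)$, with $0\log0=0$. A channel input distribution with feedback is a family $\{P(a_i\mid a_0,\dots,a_{i-1},b_{-1},b_0,\dots,b_{i-1})\}_{i=0}^n$; it is Markov if it has the form $\pi_i(a_i\mid b_{i-1})$, and then $P_i^\pi(b_i\mid b_{i-1})=\sum_{a}P(b_i\mid a,b_{i-1})\,\pi_i(a\mid b_{i-1})$. With $B^{i-1}=(B_{-1},B_0,\dots,B_{i-1})$ and $A^i=(A_0,\dots,A_i)$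 let $$I(A^n\to B^n)=\sum_{i=0}^n I(A^i;B_i\mid B^{i-1}),\qquad C_n=\sup I(A^n\to B^n),\qquad C_\infty=\lim_{n\to\infty}\frac1{n+1}C_n,$$ the supremum being over all channel input distributions with feedback, without cost constraint; $C_n$ is the finite-horizon feedback capacity and $C_\infty$ the feedback capacity. Put $$\mu=\frac{H(\beta)-H(\alpha)}{1-\alpha-\beta},\qquad \lambda=\frac1{1+2^\mu},\qquad \nu=\frac{1-(1-\beta)(1+2^\mu)}{(\alpha+\beta-1)(1+2^\mu)},\qquad C=H(\lambda)-\nu H(\alpha)-(1-\nu)H(\beta).$$ Then $\lambda,\nu\in[0,1]$ and, for every $n\ge0$ and every $\rho$, the following hold. (a) The supremum $C_n$ equals the supremum of $\sum_{i=0}^n I(A_i;B_i\mid B_{i-1})$ over the Markov input distributions. Both suprema are attained by the time-invariant Markov input distribution $\pi_i=\pi^{TI}$ for all $i\le n$, where $$\pi^{TI}(a\mid b')=\begin{cases}\nu & a=b',\\ 1-\nu & a\ne b',\end{cases}$$ whose output transition probabilities are time-invariant, $$P^{TI}(b\mid b')=\begin{cases}\lambda & b=b',\\ 1-\lambda & b\neq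 b';\end{cases}$$ both transition matrices are doubly stochastic. A Markov input distribution $\pi$ is optimal if and only if $\pi_i(\cdot\mid b')=\pi^{TI}(\cdot\mid b')$ for all $i\le n$ and all $b'$ with $P^\pi(B_{i-1}=b')>0$. Moreover, for each $b'\in\{0,1\}$ the maximum below, over the distributions of $A_0$ given $B_{-1}=b'$, exists, is attained at $\pi^{TI}(\cdot\mid b')$, and $$C_n=(n+1)\max_{\pi(\cdot\mid b')} I(A_0;B_0\mid B_{-1}=b')=(n+1)\,C .$$ (b) The limit $C_\infty$ exists and, for each $b'\in\{0,1\}$, $$C_\infty=\max_{\pi(\cdot\mid b')} I(A_0;B_0\mid B_{-1}=b')=C ,$$ independently of the law $\rho$ of the initial state. -/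

import Mathlib

open Filter Topology

noncomputable section

namespace BSSC

/-! ### Information measures on finite probability spaces (logarithms to base two) -/

/-- Law of a random variable `X` on a finite space `Ω` with probability mass function `p`:
`law p X x` is the probability that `X = x`. -/
def law {Ω X' : Type*} [Fintype Ω] [DecidableEq X'] (p : Ω → ℝ) (X : Ω → X') (x : X') : ℝ :=
  ∑ ω, if X ω = x then p ω else 0

/-- Mutual information `I(X; Y) = E[log₂ (P(X,Y) / (P(X) P(Y)))]`, in bits. -/
def mutualInfo {Ω X' Y' : Type*} [Fintype Ω] [DecidableEq X'] [DecidableEq Y']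
    (p : Ω → ℝ) (X : Ω → X') (Y : Ω → Y') : ℝ :=
  ∑ ω, p ω * Real.logb 2
    (law p (fun ω => (X ω, Y ω)) (X ω, Y ω) / (law p X (X ω) * law p Y (Y ω)))

/-- Conditional mutual information
`I(X; Y | Z) = E[log₂ (P(X,Y,Z) P(Z) / (P(X,Z) P(Y,Z)))]`, in bits.
All probabilities in the quotient are positive at every `ω` with `p ω > 0`. -/
def condMutualInfo {Ω X' Y' Z' : Type*} [Fintype Ω] [DecidableEq X'] [DecidableEq Y']
    [DecidableEq Z'] (p : Ω → ℝ) (X : Ω → X') (Y : Ω → Y') (Z : Ω → Z') : ℝ :=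
  ∑ ω, p ω * Real.logb 2
    (law p (fun ω => (X ω, Y ω, Z ω)) (X ω, Y ω, Z ω) * law p Z (Z ω) /
      (law p (fun ω => (X ω, Z ω)) (X ω, Z ω) * law p (fun ω => (Y ω, Z ω)) (Y ω, Z ω)))

/-- The binary entropy function in bits, with `0 log 0 = 0`. -/
def entropy₂ (p : ℝ) : ℝ := Real.binEntropy p / Real.log 2

/-! ### Unit memory channels with feedback

A time-invariant unit memory channel with input alphabet `A` and output alphabet `B` is a kernel
`W : B → A → B → ℝ`, where `W b' a b` is the probability of the output `b` when the previous
output is `b'` and the current input is `a`. -/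

variable {A B : Type*} [Fintype A] [Fintype B]

/-- A channel input distribution with feedback: for every time `i`, a conditional distribution
of `A_i` given `A_0, …, A_{i-1}` and `B_{-1}, B_0, …, B_{i-1}`.  Outputs are indexed from the
initial state, so that entry `j` of the output history is `B_{j-1}`.
Over the horizon `n` only the times `i = 0, …, n` are used. -/
abbrev FeedbackInput (A B : Type*) [Fintype A] : Type _ :=
  (i : ℕ) → (Fin i → A) → (Fin (i + 1) → B) → stdSimplex ℝ A

/-- A channel input distribution `π_i(a_i | b_{i-1})` that uses the last output only. -/
abbrev MarkovInput (A B : Type*) [Fintype A] : Type _ := ℕ → B → stdSimplex ℝ A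

/-- A Markov channel input distribution as a channel input distribution with feedback. -/
def MarkovInput.toFeedback (π : MarkovInput A B) : FeedbackInput A B :=
  fun i _ b => π i (b (Fin.last i))

/-- Trajectories `(A_0, …, A_n)`, `(B_{-1}, B_0, …, B_n)`; for `ω : Path A B n`,
`ω.1 i = A_i`, `ω.2 i.castSucc = B_{i-1}` and `ω.2 i.succ = B_i` for `i : Fin (n + 1)`. -/
abbrev Path (A B : Type*) (n : ℕ) : Type _ := (Fin (n + 1) → A) × (Fin (n + 2) → B)

/-- `A^i = (A_0, …, A_i)`. -/
def inputsUpTo {n : ℕ} (i : Fin (n + 1)) (ω : Path A B n) : Fin (i + 1) → A :=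
  fun j => ω.1 ⟨j, by omega⟩

/-- `A^{i-1} = (A_0, …, A_{i-1})`. -/
def inputsBefore {n : ℕ} (i : Fin (n + 1)) (ω : Path A B n) : Fin i → A :=
  fun j => ω.1 ⟨j, by omega⟩

/-- `B^{i-1} = (B_{-1}, B_0, …, B_{i-1})`. -/
def outputsBefore {n : ℕ} (i : Fin (n + 1)) (ω : Path A B n) : Fin (i + 1) → B :=
  fun j => ω.2 ⟨j, by omega⟩

/-- The joint probability mass function of `(A_0, …, A_n, B_{-1}, B_0, …, B_n)` induced by the
channel `W`, the law `ρ` of the initial state `B_{-1}` and the channel input distribution `q`. -/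
def jointLaw (W : B → A → B → ℝ) (ρ : stdSimplex ℝ B) (q : FeedbackInput A B) (n : ℕ)
    (ω : Path A B n) : ℝ :=
  ρ (ω.2 0) * ∏ i : Fin (n + 1),
    (q i (inputsBefore i ω) (outputsBefore i ω) (ω.1 i) *
      W (ω.2 i.castSucc) (ω.1 i) (ω.2 i.succ))

variable [DecidableEq A] [DecidableEq B]

/-- Directed information `I(A^n → B^n) = ∑_{i=0}^n I(A^i; B_i | B^{i-1})`. -/
def directedInfo (W : B → A → B → ℝ) (ρ : stdSimplex ℝ B) (q : FeedbackInput A B) (n : ℕ) : ℝ :=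
  ∑ i : Fin (n + 1), condMutualInfo (jointLaw W ρ q n)
    (inputsUpTo i) (fun ω => ω.2 i.succ) (outputsBefore i)

/-- `∑_{i=0}^n I(A_i; B_i | B_{i-1})` under a Markov channel input distribution. -/
def markovInfo (W : B → A → B → ℝ) (ρ : stdSimplex ℝ B) (π : MarkovInput A B) (n : ℕ) : ℝ :=
  ∑ i : Fin (n + 1), condMutualInfo (jointLaw W ρ π.toFeedback n)
    (fun ω => ω.1 i) (fun ω => ω.2 i.succ) (fun ω => ω.2 i.castSucc)

/-- The finite-horizon feedback information capacity: the supremum of directed information over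
all channel input distributions with feedback. -/
def feedbackCapacity (W : B → A → B → ℝ) (ρ : stdSimplex ℝ B) (n : ℕ) : ℝ :=
  ⨆ q : FeedbackInput A B, directedInfo W ρ q n

/-- The supremum of `∑_{i=0}^n I(A_i; B_i | B_{i-1})` over the Markov channel input
distributions `π_i(a_i | b_{i-1})`. -/
def markovCapacity (W : B → A → B → ℝ) (ρ : stdSimplex ℝ B) (n : ℕ) : ℝ :=
  ⨆ π : MarkovInput A B, markovInfo W ρ π n

/-- The single-letter information `I(A_0; B_0 | B_{-1} = b')` when `A_0` has law `p`. -/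
def singleLetterInfo (W : B → A → B → ℝ) (b' : B) (p : stdSimplex ℝ A) : ℝ :=
  mutualInfo (fun ω : A × B => p ω.1 * W b' ω.1 ω.2) Prod.fst Prod.snd

/-- The output transition probability `P^π(b | b') = ∑_a W(b | b', a) π(a | b')`. -/
def outputTransition (W : B → A → B → ℝ) (π : B → stdSimplex ℝ A) (b' b : B) : ℝ :=
  ∑ a, W b' a b * π b' a

/-! ### The binary state symmetric channel -/

/-- The channel BSSC(α, β). For the inputs `(a, b')` equal to `(0,0), (0,1), (1,0), (1,1)` the
probability of the output `0` is `α, β, 1 - β, 1 - α` respectively. -/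
def bssc (α β : ℝ) (b' a b : Fin 2) : ℝ :=
  ![!![α, β; 1 - β, 1 - α] a b', !![1 - α, 1 - β; β, α] a b'] b

/-- The symmetric matrix `[[x, 1 - x], [1 - x, x]]`. -/
def symMatrix (x : ℝ) : Matrix (Fin 2) (Fin 2) ℝ := !![x, 1 - x; 1 - x, x]

end BSSC

end

/-! The proof rests on an equal-divergence principle. Suppose a positive output kernel `Q` is such
that every row `W b' a` has the same relative entropy `C` from `Q b'`. For inputs `X`, output `Y`
and past `Z` one then has `I(X;Y|Z) = C - D(P_{YZ} ‖ P_Z Q)`, so Gibbs' inequality gives the bound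
`C`, with equality exactly when the output follows `Q` (`condMutualInfo_le_of_divergence_eq`).
Summing over time bounds directed information by `(n + 1) * C` without any dynamic programming.

For the BSSC, the previous output is repeated with probability `α` if `a = b'` and `1 - β`
otherwise. The two divergences from a Bernoulli law agree when its log odds are the slope `μ` of the
entropy between `α` and `1 - β`; its parameter is `lam`. By the mean value theorem `lam` lies
between these two points, so some input induces `Q`, with weight `ν`; it is unique because `α + β ≠
1`. -/

namespace BSSC

noncomputable section

/-! ### Finite laws, Gibbs' inequality and the equal-divergence bound -/

section Law

variable {Ω X' Y' Z' : Type*} [Fintype Ω] [DecidableEq X'] [DecidableEq Y'] [DecidableEq Z']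

lemma law_nonneg {p : Ω → ℝ} (hp : ∀ ω, 0 ≤ p ω) (X : Ω → X') (x : X') : 0 ≤ law p X x :=
  Finset.sum_nonneg fun ω _ => by split_ifs <;> simp [hp]

lemma law_pos {p : Ω → ℝ} (hp : ∀ ω, 0 ≤ p ω) (X : Ω → X') {ω : Ω} (hω : p ω ≠ 0) :
    0 < law p X (X ω) := by
  have h0 : 0 < p ω := lt_of_le_of_ne (hp ω) (Ne.symm hω)
  refine lt_of_lt_of_le h0 ?_
  have := Finset.single_le_sum (f := fun ω' => if X ω' = X ω then p ω' else 0)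
    (fun ω' _ => by split_ifs <;> simp [hp]) (Finset.mem_univ ω)
  simpa [law] using this

lemma sum_mul_comp_eq_sum_law [Fintype X'] (p : Ω → ℝ) (X : Ω → X') (f : X' → ℝ) :
    ∑ ω, p ω * f (X ω) = ∑ x, law p X x * f x := by
  simp only [law, Finset.sum_mul]
  rw [Finset.sum_comm]
  refine Finset.sum_congr rfl fun ω _ => ?_
  simp [ite_mul]

lemma sum_law [Fintype X'] (p : Ω → ℝ) (X : Ω → X') : ∑ x, law p X x = ∑ ω, p ω := by
  simpa using (sum_mul_comp_eq_sum_law p X fun _ => 1).symm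

lemma sum_law_pair [Fintype Y'] (p : Ω → ℝ) (Y : Ω → Y') (Z : Ω → Z') (z : Z') :
    ∑ y, law p (fun ω => (Y ω, Z ω)) (y, z) = law p Z z := by
  simp only [law]
  rw [Finset.sum_comm]
  refine Finset.sum_congr rfl fun ω _ => ?_
  by_cases h : Z ω = z <;> simp [h]

/-- This is `log x ≤ x - 1` at `x = v / u`, strict for `x ≠ 1`, multiplied by `u`. -/
lemma sub_le_mul_log_div {u v : ℝ} (hu : 0 ≤ u) (hv : 0 ≤ v) (huv : v = 0 → u = 0) :
    u - v ≤ u * Real.log (u / v) ∧ (u - v = u * Real.log (u / v) → u = v) := by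
  rcases hu.eq_or_lt with rfl | hu
  · simpa using ⟨hv, fun h => h.symm⟩
  have hv : 0 < v := lt_of_le_of_ne hv fun h => hu.ne' (huv h.symm)
  have hlog : Real.log (u / v) = -Real.log (v / u) := by
    rw [← Real.log_inv, inv_div]
  have key : u * (v / u - 1) = v - u := by field_simp
  rw [hlog]
  constructor
  · have := mul_le_mul_of_nonneg_left (Real.log_le_sub_one_of_pos (div_pos hv hu)) hu.le
    linarith
  · intro h
    by_contra hne
    have := mul_lt_mul_of_pos_left (Real.log_lt_sub_one_of_pos (div_pos hv hu)
      (by rw [Ne, div_eq_one_iff_eq hu.ne']; exact Ne.symm hne)) hu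
    linarith

/-- Gibbs' inequality with its equality case. -/
lemma sum_mul_logb_div {T : Type*} [Fintype T] {u v : T → ℝ} (hu : ∀ t, 0 ≤ u t)
    (hv : ∀ t, 0 ≤ v t) (huv : ∀ t, v t = 0 → u t = 0) (hsum : ∑ t, u t = ∑ t, v t) :
    0 ≤ ∑ t, u t * Real.logb 2 (u t / v t) ∧
      (∑ t, u t * Real.logb 2 (u t / v t) = 0 ↔ ∀ t, u t = v t) := by
  have h2 : 0 < Real.log 2 := Real.log_pos one_lt_two
  have hconv : ∑ t, u t * Real.logb 2 (u t / v t)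
      = (∑ t, u t * Real.log (u t / v t)) / Real.log 2 := by
    rw [Finset.sum_div]
    exact Finset.sum_congr rfl fun t _ => by rw [Real.logb, mul_div_assoc]
  have hle : ∀ t ∈ Finset.univ, u t - v t ≤ u t * Real.log (u t / v t) :=
    fun t _ => (sub_le_mul_log_div (hu t) (hv t) (huv t)).1
  have h0 : ∑ t, (u t - v t) = 0 := by rw [Finset.sum_sub_distrib, hsum, sub_self]
  rw [hconv]
  refine ⟨div_nonneg (h0 ▸ Finset.sum_le_sum hle) h2.le, ?_⟩
  rw [div_eq_zero_iff, or_iff_left h2.ne']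
  constructor
  · intro h t
    have := (Finset.sum_eq_sum_iff_of_le hle).1 (h0.trans h.symm) t (Finset.mem_univ t)
    exact (sub_le_mul_log_div (hu t) (hv t) (huv t)).2 this
  · intro h
    refine Finset.sum_eq_zero fun t _ => ?_
    rw [← h t]
    by_cases ht : u t = 0 <;> simp [ht]

/-- If all the rows `w x z` of a channel are at the same divergence `C` from the reference kernel
`Q z`, then `C` bounds the conditional mutual information between input and output, with equality
exactly when the output has the conditional law `Q`. -/
lemma condMutualInfo_le_of_divergence_eq [Fintype X'] [Fintype Y'] [Fintype Z'] {p : Ω → ℝ}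
    (hp : ∀ ω, 0 ≤ p ω) (hp1 : ∑ ω, p ω = 1) (X : Ω → X') (Y : Ω → Y') (Z : Ω → Z')
    (w : X' → Z' → Y' → ℝ) (Q : Z' → Y' → ℝ) (C : ℝ)
    (hQ : ∀ z y, 0 < Q z y) (hQ1 : ∀ z, ∑ y, Q z y = 1)
    (hw : ∀ x y z, law p (fun ω => (X ω, Y ω, Z ω)) (x, y, z)
      = law p (fun ω => (X ω, Z ω)) (x, z) * w x z y)
    (hC : ∀ x z, ∑ y, w x z y * Real.logb 2 (w x z y / Q z y) = C) :
    condMutualInfo p X Y Z ≤ C ∧ (condMutualInfo p X Y Z = C ↔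
      ∀ z y, law p (fun ω => (Y ω, Z ω)) (y, z) = law p Z z * Q z y) := by
  let u : Y' × Z' → ℝ := law p (fun ω => (Y ω, Z ω))
  let v : Y' × Z' → ℝ := fun t => law p Z t.2 * Q t.2 t.1
  -- On the support the information density factors as `(w / Q) / (u / v)`: the first factor
  -- averages to `C`, the second to the divergence of `u` from `v`.
  have hsplit : condMutualInfo p X Y Z =
      ∑ ω, p ω * Real.logb 2 (w (X ω) (Z ω) (Y ω) / Q (Z ω) (Y ω)) -
      ∑ ω, p ω * Real.logb 2 (u (Y ω, Z ω) / v (Y ω, Z ω)) := by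
    rw [condMutualInfo, ← Finset.sum_sub_distrib]
    refine Finset.sum_congr rfl fun ω _ => ?_
    by_cases h0 : p ω = 0
    · simp [h0]
    have h1 := law_pos hp (fun ω => (X ω, Y ω, Z ω)) h0
    have h2 := law_pos hp (fun ω => (X ω, Z ω)) h0
    have h3 : 0 < u (Y ω, Z ω) := law_pos hp (fun ω => (Y ω, Z ω)) h0
    have h4 := law_pos hp Z h0
    have h5 := hQ (Z ω) (Y ω)
    rw [hw] at h1 ⊢
    have h6 : w (X ω) (Z ω) (Y ω) ≠ 0 := fun h => by simp [h] at h1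
    have h7 : v (Y ω, Z ω) ≠ 0 := (mul_pos h4 h5).ne'
    rw [← mul_sub, ← Real.logb_div (div_ne_zero h6 h5.ne') (div_ne_zero h3.ne' h7)]
    congr 2
    change _ / (_ * u (Y ω, Z ω)) = _ / (_ / (law p Z (Z ω) * Q (Z ω) (Y ω)))
    field_simp
  have hfirst : ∑ ω, p ω * Real.logb 2 (w (X ω) (Z ω) (Y ω) / Q (Z ω) (Y ω)) = C := by
    rw [sum_mul_comp_eq_sum_law p (fun ω => (X ω, Y ω, Z ω))
      (fun t => Real.logb 2 (w t.1 t.2.2 t.2.1 / Q t.2.2 t.2.1))]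
    simp only [Fintype.sum_prod_type, hw]
    calc _ = ∑ x, ∑ z, law p (fun ω => (X ω, Z ω)) (x, z) * C := by
          refine Finset.sum_congr rfl fun x _ => ?_
          rw [Finset.sum_comm]
          refine Finset.sum_congr rfl fun z _ => ?_
          rw [← hC x z, Finset.mul_sum]
          exact Finset.sum_congr rfl fun y _ => mul_assoc _ _ _
      _ = C := by
          simp only [← Finset.sum_mul]
          rw [← Fintype.sum_prod_type, sum_law, hp1, one_mul]
  have hsecond : ∑ ω, p ω * Real.logb 2 (u (Y ω, Z ω) / v (Y ω, Z ω))
      = ∑ t, u t * Real.logb 2 (u t / v t) :=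
    sum_mul_comp_eq_sum_law p (fun ω => (Y ω, Z ω)) (fun t => Real.logb 2 (u t / v t))
  have hu : ∀ t, 0 ≤ u t := law_nonneg hp _
  obtain ⟨hD, hD0⟩ := sum_mul_logb_div (u := u) (v := v) hu
    (fun t => mul_nonneg (law_nonneg hp _ _) (hQ _ _).le)
    -- Absolute continuity: `Q` is positive, so `v` vanishes only where `Z` has no mass.
    (by
      rintro ⟨y, z⟩ h
      have h0 : law p Z z = 0 := (mul_eq_zero.1 h).resolve_right (hQ z y).ne'
      rw [← sum_law_pair p Y Z z] at h0
      exact (Finset.sum_eq_zero_iff_of_nonneg fun y _ => hu (y, z)).1 h0 y (Finset.mem_univ y))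
    (by
      rw [sum_law, Fintype.sum_prod_type_right]
      simp only [v, ← Finset.mul_sum, hQ1, mul_one]
      exact (sum_law p Z).symm)
  rw [hsplit, hfirst, hsecond]
  refine ⟨by linarith, ?_⟩
  rw [sub_eq_self, hD0]
  exact ⟨fun h z y => h (y, z), fun h t => h t.2 t.1⟩

/-- Lets the single-letter bound come from the conditional one. -/
lemma mutualInfo_eq_condMutualInfo {p : Ω → ℝ} (hp1 : ∑ ω, p ω = 1) (X : Ω → X') (Y : Ω → Y') :
    mutualInfo p X Y = condMutualInfo p X Y (fun _ => ()) := by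
  simp [mutualInfo, condMutualInfo, law, hp1, Prod.ext_iff]

end Law

/-! ### Causal structure of the joint law -/

section Trajectories

variable {A B : Type*} [Fintype A] [Fintype B]

/-- The joint probability mass function of `(A_0, …, A_{m-1}, B_{-1}, …, B_{m-1})`. -/
def prefixLaw (W : B → A → B → ℝ) (ρ : stdSimplex ℝ B) (q : FeedbackInput A B) (m : ℕ)
    (ω : (Fin m → A) × (Fin (m + 1) → B)) : ℝ :=
  ρ (ω.2 0) * ∏ i : Fin m,
    (q i (fun j : Fin i => ω.1 ⟨j, by omega⟩) (fun j : Fin (i + 1) => ω.2 ⟨j, by omega⟩) (ω.1 i) *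
      W (ω.2 i.castSucc) (ω.1 i) (ω.2 i.succ))

/-- Expectation of a function of `(A_0, …, A_{m-1}, B_{-1}, …, B_{m-1})`. -/
def prefixExp (W : B → A → B → ℝ) (ρ : stdSimplex ℝ B) (q : FeedbackInput A B) (m : ℕ)
    (F : (Fin m → A) × (Fin (m + 1) → B) → ℝ) : ℝ :=
  ∑ ω, prefixLaw W ρ q m ω * F ω

variable {W : B → A → B → ℝ} (ρ : stdSimplex ℝ B) (q : FeedbackInput A B)

lemma prefixLaw_snoc (m : ℕ) (x : Fin m → A) (y : Fin (m + 1) → B) (a : A) (b : B) :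
    prefixLaw W ρ q (m + 1) (Fin.snoc (α := fun _ => A) x a, Fin.snoc (α := fun _ => B) y b) =
      prefixLaw W ρ q m (x, y) * (q m x y a * W (y (Fin.last m)) a b) := by
  have hx : ∀ (j : ℕ) (h : j < m + 1) (h' : j < m),
      (Fin.snoc (α := fun _ => A) x a : Fin (m + 1) → A) ⟨j, h⟩ = x ⟨j, h'⟩ := fun j h h' => by
    simp [Fin.snoc, h']
  have hy : ∀ (j : ℕ) (h : j < m + 2) (h' : j < m + 1),
      (Fin.snoc (α := fun _ => B) y b : Fin (m + 2) → B) ⟨j, h⟩ = y ⟨j, h'⟩ := fun j h h' => by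
    simp [Fin.snoc, h']
  unfold prefixLaw
  rw [Fin.prod_univ_castSucc, ← mul_assoc]
  congr 1
  · congr 1
    refine Finset.prod_congr rfl fun i _ => ?_
    have e1 : (fun j : Fin (i.castSucc : Fin (m + 1)) =>
        (Fin.snoc (α := fun _ => A) x a : Fin (m + 1) → A) ⟨j, by omega⟩)
        = fun j : Fin i => x ⟨j, by omega⟩ := by
      funext j; exact hx _ _ _
    have e2 : (fun j : Fin ((i.castSucc : Fin (m + 1)) + 1) =>
        (Fin.snoc (α := fun _ => B) y b : Fin (m + 2) → B)
          ⟨j, by have := j.2; have := i.2; simp at *; omega⟩)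
        = fun j : Fin (i + 1) => y ⟨j, by omega⟩ := by
      funext j; exact hy _ _ _
    have e3 : (Fin.snoc (α := fun _ => B) y b : Fin (m + 2) → B) i.castSucc.succ = y i.succ := by
      rw [Fin.succ_castSucc, Fin.snoc_castSucc]
    dsimp only
    rw [Fin.snoc_castSucc, Fin.snoc_castSucc, e3]
    -- The history types depend on `↑i.castSucc`, which is `i` by definition; congruence terms are
    -- checked up to this identification.
    exact congrArg (· * _) (congrFun (congrArg _ (congrArg₂ (q i) e1 e2)) _)
  · have e1 : (fun j : Fin (Fin.last m) =>
        (Fin.snoc (α := fun _ => A) x a : Fin (m + 1) → A) ⟨j, by omega⟩) = x := by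
      funext j; exact hx _ _ j.2
    have e2 : (fun j : Fin ((Fin.last m : Fin (m + 1)) + 1) =>
        (Fin.snoc (α := fun _ => B) y b : Fin (m + 2) → B)
          ⟨j, j.2.trans (Nat.lt_succ_self _)⟩) = y := by
      funext j; exact hy _ _ j.2
    dsimp only
    rw [Fin.snoc_castSucc, Fin.snoc_last, Fin.succ_last, Fin.snoc_last]
    exact congrArg (· * _) (congrFun (congrArg _ (congrArg₂ (q m) e1 e2)) _)

lemma prefixExp_succ (m : ℕ) (F : (Fin (m + 1) → A) × (Fin (m + 2) → B) → ℝ) :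
    prefixExp W ρ q (m + 1) F = prefixExp W ρ q m fun ω =>
      ∑ a, q m ω.1 ω.2 a * ∑ b, W (ω.2 (Fin.last m)) a b *
        F (Fin.snoc (α := fun _ => A) ω.1 a, Fin.snoc (α := fun _ => B) ω.2 b) := by
  unfold prefixExp
  rw [Fintype.sum_prod_type, ← (Fin.snocEquiv fun _ : Fin (m + 1) => A).sum_comp,
    Fintype.sum_prod_type_right, Fintype.sum_prod_type]
  refine Finset.sum_congr rfl fun x _ => ?_
  simp_rw [← (Fin.snocEquiv fun _ : Fin (m + 2) => B).sum_comp, Fintype.sum_prod_type_right]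
  rw [Finset.sum_comm]
  refine Finset.sum_congr rfl fun y _ => ?_
  rw [Finset.mul_sum]
  refine Finset.sum_congr rfl fun a _ => ?_
  rw [Finset.mul_sum, Finset.mul_sum]
  refine Finset.sum_congr rfl fun b _ => ?_
  change prefixLaw W ρ q (m + 1) (Fin.snoc (α := fun _ => A) x a, Fin.snoc (α := fun _ => B) y b)
    * F (Fin.snoc (α := fun _ => A) x a, Fin.snoc (α := fun _ => B) y b) = _
  rw [prefixLaw_snoc]
  ring

/-- Causality: the latest output, then the latest input, sums out to one, and this is iterated back
to time `k`. -/
lemma prefixExp_restrict (hW : ∀ b' a, ∑ b, W b' a b = 1) {k m : ℕ} (hkm : k ≤ m)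
    (F : (Fin k → A) × (Fin (k + 1) → B) → ℝ) :
    prefixExp W ρ q m (fun ω => F (fun j : Fin k => ω.1 ⟨j, by omega⟩,
      fun j : Fin (k + 1) => ω.2 ⟨j, by omega⟩)) = prefixExp W ρ q k F := by
  induction m, hkm using Nat.le_induction with
  | base => rfl
  | succ m hkm ih =>
    rw [← ih, prefixExp_succ]
    congr 1
    funext ω
    have e : ∀ a b, F (fun j : Fin k => (Fin.snoc (α := fun _ => A) ω.1 a : Fin (m + 1) → A)
          ⟨j, by omega⟩,
        fun j : Fin (k + 1) => (Fin.snoc (α := fun _ => B) ω.2 b : Fin (m + 2) → B) ⟨j, by omega⟩)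
        = F (fun j : Fin k => ω.1 ⟨j, by omega⟩, fun j : Fin (k + 1) => ω.2 ⟨j, by omega⟩) := by
      intro a b
      have h1 : ∀ j : Fin k, (j : ℕ) < m := fun j => by omega
      have h2 : ∀ j : Fin (k + 1), (j : ℕ) < m + 1 := fun j => by omega
      simp [Fin.snoc, h1, h2]
    simp only [e, ← Finset.sum_mul, hW, one_mul]
    rw [stdSimplex.sum_eq_one, one_mul]

/-- Conditioning on `(A^{i-1}, B^{i-1})`. -/
lemma sum_jointLaw_mul (hW : ∀ b' a, ∑ b, W b' a b = 1) {n : ℕ} (i : Fin (n + 1))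
    (G : (Fin i → A) → (Fin (i + 1) → B) → A → B → ℝ) :
    ∑ ω, jointLaw W ρ q n ω * G (inputsBefore i ω) (outputsBefore i ω) (ω.1 i) (ω.2 i.succ) =
      ∑ ω, jointLaw W ρ q n ω *
        ∑ a, q i (inputsBefore i ω) (outputsBefore i ω) a *
          ∑ b, W (ω.2 i.castSucc) a b * G (inputsBefore i ω) (outputsBefore i ω) a b := by
  have hL := prefixExp_restrict ρ q hW (k := i + 1) (m := n + 1) (by omega)
    (fun ω => G (fun j => ω.1 ⟨j, by omega⟩) (fun j => ω.2 ⟨j, by omega⟩)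
      (ω.1 (Fin.last i)) (ω.2 (Fin.last (i + 1))))
  have hR := prefixExp_restrict ρ q hW (k := i) (m := n + 1) (by omega)
    (fun ω => ∑ a, q i ω.1 ω.2 a * ∑ b, W (ω.2 (Fin.last i)) a b * G ω.1 ω.2 a b)
  have h : ∀ j : Fin (i + 1), (j : ℕ) ≤ i := fun j => Nat.lt_succ_iff.1 j.2
  -- `jointLaw` at horizon `n` unfolds to `prefixLaw` at `n + 1`; only the step from `i` to `i + 1`
  -- remains.
  refine hL.trans (Eq.trans ?_ hR.symm)
  rw [prefixExp_succ]
  congr 1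
  funext ω
  refine Finset.sum_congr rfl fun a _ => congrArg _ (Finset.sum_congr rfl fun b _ => ?_)
  simp [Fin.snoc, h]

lemma sum_jointLaw (hW : ∀ b' a, ∑ b, W b' a b = 1) (n : ℕ) :
    ∑ ω, jointLaw W ρ q n ω = 1 := by
  have h := prefixExp_restrict ρ q hW (k := 0) (m := n + 1) (by omega) fun _ => 1
  have h0 : prefixExp W ρ q 0 (fun _ => 1) = 1 := by
    simp only [prefixExp, prefixLaw, Finset.univ_eq_empty, Finset.prod_empty, mul_one,
      Fintype.sum_prod_type, Finset.univ_unique, Finset.sum_singleton]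
    rw [← (Equiv.funUnique (Fin 1) B).symm.sum_comp]
    exact stdSimplex.sum_eq_one ρ
  rw [h0] at h
  simp only [prefixExp, mul_one] at h
  exact h

lemma jointLaw_nonneg (hW : ∀ b' a b, 0 ≤ W b' a b) (n : ℕ) (ω : Path A B n) :
    0 ≤ jointLaw W ρ q n ω :=
  mul_nonneg (ρ.2.1 _) (Finset.prod_nonneg fun _ _ => mul_nonneg ((q _ _ _).2.1 _) (hW _ _ _))

variable [DecidableEq B]

/-- Any statistics of the histories that retain `A_i` and `B_{i-1}` see the same channel. Full
histories serve directed information, last symbols the Markov sum. -/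
lemma law_channel (hW : ∀ b' a, ∑ b, W b' a b = 1) {n : ℕ} (i : Fin (n + 1))
    {X' Z' : Type*} [DecidableEq X'] [DecidableEq Z']
    (f : (Fin (i + 1) → A) → X') (g : (Fin (i + 1) → B) → Z') (f' : X' → A) (g' : Z' → B)
    (hf : ∀ x, f' (f x) = x (Fin.last i)) (hg : ∀ y, g' (g y) = y (Fin.last i))
    (x : X') (b : B) (z : Z') :
    law (jointLaw W ρ q n) (fun ω => (f (inputsUpTo i ω), ω.2 i.succ, g (outputsBefore i ω)))
        (x, b, z) =
      law (jointLaw W ρ q n) (fun ω => (f (inputsUpTo i ω), g (outputsBefore i ω))) (x, z) *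
        W (g' z) (f' x) b := by
  have hin : ∀ ω : Path A B n, inputsUpTo i ω =
      Fin.snoc (α := fun _ => A) (inputsBefore i ω) (ω.1 i) := by
    intro ω
    funext j
    refine Fin.lastCases ?_ (fun j => ?_) j
    · simp [inputsUpTo]
    · simp [inputsUpTo, inputsBefore]
  let S : (Fin i → A) → (Fin (i + 1) → B) → A → ℝ := fun x' y a =>
    if (f (Fin.snoc (α := fun _ => A) x' a), g y) = (x, z) then 1 else 0
  have h1 := sum_jointLaw_mul ρ q hW i fun x' y a b' => S x' y a * if b' = b then 1 else 0
  have h2 := sum_jointLaw_mul ρ q hW i fun x' y a _ => S x' y a * W (g' z) (f' x) b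
  have e1 : law (jointLaw W ρ q n)
      (fun ω => (f (inputsUpTo i ω), ω.2 i.succ, g (outputsBefore i ω))) (x, b, z) =
      ∑ ω, jointLaw W ρ q n ω * (S (inputsBefore i ω) (outputsBefore i ω) (ω.1 i) *
        if ω.2 i.succ = b then 1 else 0) := by
    refine Finset.sum_congr rfl fun ω _ => ?_
    simp only [S, ← hin, Prod.mk.injEq]
    by_cases c1 : f (inputsUpTo i ω) = x <;> by_cases c2 : ω.2 i.succ = b <;>
      by_cases c3 : g (outputsBefore i ω) = z <;> simp [c1, c2, c3]
  have e2 : law (jointLaw W ρ q n) (fun ω => (f (inputsUpTo i ω), g (outputsBefore i ω))) (x, z) *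
        W (g' z) (f' x) b =
      ∑ ω, jointLaw W ρ q n ω * (S (inputsBefore i ω) (outputsBefore i ω) (ω.1 i) *
        W (g' z) (f' x) b) := by
    rw [law, Finset.sum_mul]
    refine Finset.sum_congr rfl fun ω _ => ?_
    simp only [S, ← hin]
    split_ifs <;> simp
  rw [e1, e2, h1, h2]
  refine Finset.sum_congr rfl fun ω _ => congrArg _ (Finset.sum_congr rfl fun a _ => congrArg _ ?_)
  rw [← Finset.sum_mul, hW, one_mul]
  -- On the event selected by `S`, `f'` and `g'` recover the actual current input and last output,
  -- so the two kernels coincide.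
  by_cases hS : (f (Fin.snoc (α := fun _ => A) (inputsBefore i ω) a), g (outputsBefore i ω))
      = (x, z)
  · obtain ⟨rfl, rfl⟩ := Prod.mk.inj hS
    simp [S, hf, hg]
    rfl
  · simp only [S, if_neg hS, zero_mul, mul_zero, Finset.sum_const_zero]

/-- A Markov input ignores past inputs, so averaging over `A_i` leaves a kernel in `B_{i-1}` alone.
-/
lemma law_output (hW : ∀ b' a, ∑ b, W b' a b = 1) (π : MarkovInput A B) {n : ℕ} (i : Fin (n + 1))
    {Z' : Type*} [DecidableEq Z'] (g : (Fin (i + 1) → B) → Z') (g' : Z' → B)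
    (hg : ∀ y, g' (g y) = y (Fin.last i)) (b : B) (z : Z') :
    law (jointLaw W ρ π.toFeedback n) (fun ω => (ω.2 i.succ, g (outputsBefore i ω))) (b, z) =
      law (jointLaw W ρ π.toFeedback n) (fun ω => g (outputsBefore i ω)) z *
        outputTransition W (π i) (g' z) b := by
  have h1 := sum_jointLaw_mul ρ π.toFeedback hW i fun _ y _ b' =>
    (if g y = z then 1 else 0) * if b' = b then 1 else 0
  have e1 : law (jointLaw W ρ π.toFeedback n) (fun ω => (ω.2 i.succ, g (outputsBefore i ω)))
      (b, z) = ∑ ω, jointLaw W ρ π.toFeedback n ω *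
        ((if g (outputsBefore i ω) = z then 1 else 0) * if ω.2 i.succ = b then 1 else 0) := by
    refine Finset.sum_congr rfl fun ω _ => ?_
    by_cases c2 : ω.2 i.succ = b <;> by_cases c3 : g (outputsBefore i ω) = z <;> simp [c2, c3]
  rw [e1, h1, law, Finset.sum_mul]
  refine Finset.sum_congr rfl fun ω _ => ?_
  by_cases hz : g (outputsBefore i ω) = z
  · subst hz
    simp only [if_true, mul_ite, mul_one, mul_zero, Finset.sum_ite_eq',
      Finset.mem_univ, hg, outputTransition]
    exact congrArg _ (Finset.sum_congr rfl fun a _ => mul_comm _ _)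
  · simp [hz]

end Trajectories

/-! ### Capacity bounds and equality cases for equal-divergence channels -/

section EqualDivergence

variable {A B : Type*} [Fintype A] [Fintype B] [DecidableEq A] [DecidableEq B]
  {W : B → A → B → ℝ} {Q : B → B → ℝ} {C : ℝ}

lemma directedInfo_le (hW0 : ∀ b' a b, 0 ≤ W b' a b) (hW : ∀ b' a, ∑ b, W b' a b = 1)
    (hQ : ∀ b' b, 0 < Q b' b) (hQ1 : ∀ b', ∑ b, Q b' b = 1)
    (hC : ∀ b' a, ∑ b, W b' a b * Real.logb 2 (W b' a b / Q b' b) = C)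
    (ρ : stdSimplex ℝ B) (q : FeedbackInput A B) (n : ℕ) :
    directedInfo W ρ q n ≤ (n + 1) * C ∧ (directedInfo W ρ q n = (n + 1) * C ↔
      ∀ (i : Fin (n + 1)) (z : Fin (i + 1) → B) (b : B),
        law (jointLaw W ρ q n) (fun ω => (ω.2 i.succ, outputsBefore i ω)) (b, z) =
          law (jointLaw W ρ q n) (outputsBefore i) z * Q (z (Fin.last i)) b) := by
  have key := fun i : Fin (n + 1) => condMutualInfo_le_of_divergence_eq
    (jointLaw_nonneg ρ q hW0 n) (sum_jointLaw ρ q hW n) (inputsUpTo i) (fun ω => ω.2 i.succ)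
    (outputsBefore i) (fun x z b => W (z (Fin.last i)) (x (Fin.last i)) b)
    (fun z b => Q (z (Fin.last i)) b) C (fun z b => hQ _ b) (fun z => hQ1 _)
    (fun x b z => law_channel ρ q hW i id id (fun x => x (Fin.last i)) (fun z => z (Fin.last i))
      (fun _ => rfl) (fun _ => rfl) x b z)
    (fun x z => hC _ _)
  have hsum : ((n : ℝ) + 1) * C = ∑ _i : Fin (n + 1), C := by simp
  have hle := fun (i : Fin (n + 1)) (_ : i ∈ Finset.univ) => (key i).1
  rw [hsum]
  refine ⟨Finset.sum_le_sum hle, (Finset.sum_eq_sum_iff_of_le hle).trans ?_⟩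
  exact ⟨fun h i => (key i).2.1 (h i (Finset.mem_univ i)), fun h i _ => (key i).2.2 (h i)⟩

lemma directedInfo_eq (hW0 : ∀ b' a b, 0 ≤ W b' a b) (hW : ∀ b' a, ∑ b, W b' a b = 1)
    (hQ : ∀ b' b, 0 < Q b' b) (hQ1 : ∀ b', ∑ b, Q b' b = 1)
    (hC : ∀ b' a, ∑ b, W b' a b * Real.logb 2 (W b' a b / Q b' b) = C)
    (ρ : stdSimplex ℝ B) (π : MarkovInput A B) (n : ℕ)
    (hπ : ∀ i b' b, outputTransition W (π i) b' b = Q b' b) :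
    directedInfo W ρ π.toFeedback n = (n + 1) * C := by
  refine (directedInfo_le hW0 hW hQ hQ1 hC ρ π.toFeedback n).2.2 fun i z b => ?_
  rw [← hπ i]
  exact law_output ρ hW π i id (fun z => z (Fin.last i)) (fun _ => rfl) b z

lemma markovInfo_le (hW0 : ∀ b' a b, 0 ≤ W b' a b) (hW : ∀ b' a, ∑ b, W b' a b = 1)
    (hQ : ∀ b' b, 0 < Q b' b) (hQ1 : ∀ b', ∑ b, Q b' b = 1)
    (hC : ∀ b' a, ∑ b, W b' a b * Real.logb 2 (W b' a b / Q b' b) = C)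
    (ρ : stdSimplex ℝ B) (π : MarkovInput A B) (n : ℕ) :
    markovInfo W ρ π n ≤ (n + 1) * C ∧ (markovInfo W ρ π n = (n + 1) * C ↔
      ∀ (i : Fin (n + 1)) (b' : B),
        0 < law (jointLaw W ρ π.toFeedback n) (fun ω => ω.2 i.castSucc) b' →
          ∀ b, outputTransition W (π i) b' b = Q b' b) := by
  have hp := jointLaw_nonneg ρ π.toFeedback hW0 n
  have key := fun i : Fin (n + 1) => condMutualInfo_le_of_divergence_eq
    hp (sum_jointLaw ρ π.toFeedback hW n) (fun ω => ω.1 i) (fun ω => ω.2 i.succ)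
    (fun ω => ω.2 i.castSucc) (fun a b' b => W b' a b) Q C hQ hQ1
    (fun a b b' => law_channel ρ π.toFeedback hW i (fun x => x (Fin.last i))
      (fun z => z (Fin.last i)) id id (fun _ => rfl) (fun _ => rfl) a b b')
    (fun a b' => hC b' a)
  have hsum : ((n : ℝ) + 1) * C = ∑ _i : Fin (n + 1), C := by simp
  have hle := fun (i : Fin (n + 1)) (_ : i ∈ Finset.univ) => (key i).1
  rw [hsum]
  refine ⟨Finset.sum_le_sum hle, (Finset.sum_eq_sum_iff_of_le hle).trans ?_⟩
  simp only [Finset.mem_univ, true_implies]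
  refine forall_congr' fun i => (key i).2.trans (forall_congr' fun b' => ?_)
  have hout := fun b => law_output ρ hW π i (fun z => z (Fin.last i)) id (fun _ => rfl) b b'
  change ∀ b, law (jointLaw W ρ π.toFeedback n) (fun ω => (ω.2 i.succ, ω.2 i.castSucc)) (b, b') =
    law (jointLaw W ρ π.toFeedback n) (fun ω => ω.2 i.castSucc) b' *
      outputTransition W (π i) b' b at hout
  simp only [hout]
  constructor
  · exact fun h hpos b => mul_left_cancel₀ hpos.ne' (h b)
  · intro h b
    rcases (law_nonneg hp (fun ω => ω.2 i.castSucc) b').eq_or_lt with h0 | h0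
    -- A state of probability zero imposes no constraint.
    · rw [← h0, zero_mul, zero_mul]
    · rw [h h0 b]

lemma singleLetterInfo_le (hW0 : ∀ b' a b, 0 ≤ W b' a b) (hW : ∀ b' a, ∑ b, W b' a b = 1)
    (hQ : ∀ b' b, 0 < Q b' b) (hQ1 : ∀ b', ∑ b, Q b' b = 1)
    (hC : ∀ b' a, ∑ b, W b' a b * Real.logb 2 (W b' a b / Q b' b) = C)
    (b' : B) (p : stdSimplex ℝ A) :
    singleLetterInfo W b' p ≤ C ∧ (singleLetterInfo W b' p = C ↔
      ∀ b, ∑ a, W b' a b * p a = Q b' b) := by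
  have hp1 : ∑ ω : A × B, p ω.1 * W b' ω.1 ω.2 = 1 := by
    rw [Fintype.sum_prod_type]
    simp only [← Finset.mul_sum, hW, mul_one]
    exact stdSimplex.sum_eq_one p
  have hX : ∀ a, law (fun ω : A × B => p ω.1 * W b' ω.1 ω.2) (fun ω => (ω.1, ())) (a, ()) =
      p a := by
    intro a
    simp [law, Fintype.sum_prod_type, ← Finset.mul_sum, hW, Finset.sum_ite_irrel]
  have hY : ∀ b, law (fun ω : A × B => p ω.1 * W b' ω.1 ω.2) (fun ω => (ω.2, ())) (b, ()) =
      ∑ a, W b' a b * p a := by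
    intro b
    simp [law, Fintype.sum_prod_type, mul_comm]
  have hZ : law (fun ω : A × B => p ω.1 * W b' ω.1 ω.2) (fun _ => ()) () = 1 := by
    simpa [law] using hp1
  have key := condMutualInfo_le_of_divergence_eq
    (p := fun ω : A × B => p ω.1 * W b' ω.1 ω.2)
    (fun ω => mul_nonneg (p.2.1 ω.1) (hW0 b' ω.1 ω.2)) hp1 Prod.fst Prod.snd
    (fun _ => ()) (fun a _ b => W b' a b) (fun _ b => Q b' b) C (fun _ b => hQ b' b)
    (fun _ => hQ1 b')
    (by
      intro a b z
      refine Eq.trans ?_ (congrArg (· * W b' a b) (hX a)).symm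
      simp only [law, Fintype.sum_prod_type, Prod.mk.injEq, and_true]
      rw [Finset.sum_eq_single a (fun a' _ h => by simp [h]) (by simp)]
      simp)
    (fun a _ => hC b' a)
  rw [singleLetterInfo, mutualInfo_eq_condMutualInfo hp1]
  refine ⟨key.1, key.2.trans ?_⟩
  constructor
  · intro h b
    have := h () b
    rwa [hZ, one_mul, hY] at this
  · intro h _ b
    rw [hZ, one_mul, ← h b]
    exact hY b

end EqualDivergence

/-! ### Binary entropy and the symmetric channel -/

section BinaryStateSymmetric

/-- Apart from the entropy term the divergence is affine in `x`, so equating two of them is a linear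
equation in the log odds of `l`. -/
lemma divergence_eq {x l : ℝ} (hl0 : 0 < l) (hl1 : l < 1) :
    x * Real.logb 2 (x / l) + (1 - x) * Real.logb 2 ((1 - x) / (1 - l)) =
      -entropy₂ x - x * Real.logb 2 l - (1 - x) * Real.logb 2 (1 - l) := by
  have h : ∀ u v : ℝ, v ≠ 0 →
      u * Real.logb 2 (u / v) = u * Real.logb 2 u - u * Real.logb 2 v := by
    intro u v hv
    by_cases hu : u = 0
    · simp [hu]
    · rw [Real.logb_div hu hv, mul_sub]
  rw [h _ _ hl0.ne', h _ _ (by linarith), entropy₂, Real.binEntropy]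
  simp only [Real.log_inv, Real.logb]
  ring

lemma entropy₂_one_sub (x : ℝ) : entropy₂ (1 - x) = entropy₂ x := by
  rw [entropy₂, entropy₂, Real.binEntropy_one_sub]

/-- Mean value theorem for the binary entropy function. -/
lemma exists_slope_entropy₂ {x y : ℝ} (hx : 0 ≤ x) (hxy : x < y) (hy : y ≤ 1) :
    ∃ ξ ∈ Set.Ioo x y, 1 / (1 + (2 : ℝ) ^ ((entropy₂ y - entropy₂ x) / (y - x))) = ξ := by
  obtain ⟨ξ, hξ, h⟩ := exists_deriv_eq_slope Real.binEntropy hxy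
    Real.binEntropy_continuous.continuousOn fun z hz =>
      (Real.differentiableAt_binEntropy (by linarith [hz.1]) (by linarith [hz.2])
        ).differentiableWithinAt
  refine ⟨ξ, hξ, ?_⟩
  have h0 : 0 < ξ := by linarith [hξ.1]
  have h1 : 0 < 1 - ξ := by linarith [hξ.2]
  rw [Real.deriv_binEntropy, ← Real.log_div h1.ne' h0.ne'] at h
  -- The derivative of the entropy is the log odds, which `1 / (1 + 2 ^ s)` inverts.
  have hs : (entropy₂ y - entropy₂ x) / (y - x) = Real.logb 2 ((1 - ξ) / ξ) := by
    rw [Real.logb, h, entropy₂, entropy₂]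
    ring
  rw [hs, Real.rpow_logb two_pos (by norm_num) (div_pos h1 h0)]
  field_simp
  ring

/-- Outputs are read relative to `b'`: repeat it, or move to `1 - b'`, the other state in `Fin 2`.
-/
lemma bssc_sum_mul (α β : ℝ) (b' a : Fin 2) (f : ℝ → Fin 2 → ℝ) :
    ∑ b, f (bssc α β b' a b) b =
      f (if a = b' then α else 1 - β) b' + f (1 - if a = b' then α else 1 - β) (1 - b') := by
  fin_cases b' <;> fin_cases a <;> simp [bssc, add_comm]

lemma bssc_nonneg {α β : ℝ} (hα : α ∈ Set.Icc (0 : ℝ) 1) (hβ : β ∈ Set.Icc (0 : ℝ) 1)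
    (b' a b : Fin 2) : 0 ≤ bssc α β b' a b := by
  obtain ⟨h1, h2⟩ := hα
  obtain ⟨h3, h4⟩ := hβ
  fin_cases b' <;> fin_cases a <;> fin_cases b <;> simp [bssc] <;> linarith

lemma bssc_sum (α β : ℝ) (b' a : Fin 2) : ∑ b, bssc α β b' a b = 1 := by
  rw [bssc_sum_mul α β b' a fun x _ => x, add_sub_cancel]

lemma symMatrix_mem_doublyStochastic {x : ℝ} (h0 : 0 ≤ x) (h1 : x ≤ 1) :
    symMatrix x ∈ doublyStochastic ℝ (Fin 2) := by
  rw [mem_doublyStochastic_iff_sum]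
  refine ⟨fun i j => ?_, fun i => ?_, fun j => ?_⟩
  · fin_cases i <;> fin_cases j <;> simp [symMatrix, h0, h1]
  · fin_cases i <;> simp [symMatrix]
  · fin_cases j <;> simp [symMatrix]

lemma outputTransition_bssc (α β : ℝ) (π : Fin 2 → stdSimplex ℝ (Fin 2)) (b' b : Fin 2) :
    outputTransition (bssc α β) π b' b =
      symMatrix (1 - β + (α + β - 1) * π b' b') b b' := by
  have h : ∀ c, π c 1 = 1 - π c 0 := fun c => eq_sub_of_add_eq' (stdSimplex.add_eq_one (π c))
  fin_cases b' <;> fin_cases b <;>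
    simp [outputTransition, bssc, symMatrix, h] <;> ring

lemma symMatrix_injective_col {x y : ℝ} {b' : Fin 2}
    (h : ∀ b, symMatrix x b b' = symMatrix y b b') : x = y := by
  have := h b'
  fin_cases b' <;> simpa [symMatrix] using this

end BinaryStateSymmetric

end

end BSSC

/-! ### The theorem for the BSSC -/

theorem mainTheorem1 (α β : ℝ) (hα : α ∈ Set.Icc (0 : ℝ) 1) (hβ : β ∈ Set.Icc (0 : ℝ) 1)
    (hαβ : α + β ≠ 1) (μ lam ν C : ℝ)
    (hμ : μ = (BSSC.entropy₂ β - BSSC.entropy₂ α) / (1 - α - β))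
    (hlam : lam = 1 / (1 + (2 : ℝ) ^ μ))
    (hν : ν = (1 - (1 - β) * (1 + (2 : ℝ) ^ μ)) / ((α + β - 1) * (1 + (2 : ℝ) ^ μ)))
    (hC : C = BSSC.entropy₂ lam - ν * BSSC.entropy₂ α - (1 - ν) * BSSC.entropy₂ β) :
    -- the two transition matrices are doubly stochastic
    BSSC.symMatrix ν ∈ doublyStochastic ℝ (Fin 2) ∧
    BSSC.symMatrix lam ∈ doublyStochastic ℝ (Fin 2) ∧
    ∃ πTI : Fin 2 → stdSimplex ℝ (Fin 2),
      -- the time-invariant input distribution and the output transition matrix it induces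
      (∀ b' a, πTI b' a = BSSC.symMatrix ν a b') ∧
      (∀ b' b, BSSC.outputTransition (BSSC.bssc α β) πTI b' b = BSSC.symMatrix lam b b') ∧
      -- the single-letter maximum exists, has the value `C` for each initial state, and is
      -- attained at `πTI`
      (∀ b', IsGreatest (Set.range (BSSC.singleLetterInfo (BSSC.bssc α β) b')) C ∧
        BSSC.singleLetterInfo (BSSC.bssc α β) b' (πTI b') = C) ∧
      -- finite horizon, for an arbitrary law `ρ` of the initial state
      (∀ (ρ : stdSimplex ℝ (Fin 2)) (n : ℕ),
        -- `πTI`, used at all times, is optimal among all input distributions with feedback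
        IsGreatest
          (Set.range fun q : BSSC.FeedbackInput (Fin 2) (Fin 2) =>
            BSSC.directedInfo (BSSC.bssc α β) ρ q n)
          (BSSC.directedInfo (BSSC.bssc α β) ρ
            (BSSC.MarkovInput.toFeedback fun _ => πTI) n) ∧
        -- it is optimal among the input distributions `π_i(a_i | b_{i-1})`
        IsGreatest
          (Set.range fun π : BSSC.MarkovInput (Fin 2) (Fin 2) =>
            BSSC.markovInfo (BSSC.bssc α β) ρ π n)
          (BSSC.markovInfo (BSSC.bssc α β) ρ (fun _ => πTI) n) ∧
        -- and it is the only optimal one there, up to states `b_{i-1}` of probability zero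
        (∀ π : BSSC.MarkovInput (Fin 2) (Fin 2),
          BSSC.markovInfo (BSSC.bssc α β) ρ π n = BSSC.markovCapacity (BSSC.bssc α β) ρ n ↔
            ∀ (i : Fin (n + 1)) (b' : Fin 2),
              0 < BSSC.law (BSSC.jointLaw (BSSC.bssc α β) ρ π.toFeedback n)
                (fun ω => ω.2 i.castSucc) b' →
              π i b' = πTI b') ∧
        -- the value of the finite-horizon feedback capacity
        BSSC.feedbackCapacity (BSSC.bssc α β) ρ n =
          BSSC.markovCapacity (BSSC.bssc α β) ρ n ∧
        (∀ b', BSSC.feedbackCapacity (BSSC.bssc α β) ρ n =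
          (n + 1) * ⨆ p, BSSC.singleLetterInfo (BSSC.bssc α β) b' p) ∧
        BSSC.feedbackCapacity (BSSC.bssc α β) ρ n = (n + 1) * C) ∧
      -- the feedback capacity per unit time
      (∀ ρ : stdSimplex ℝ (Fin 2),
        (∀ b', Tendsto (fun n : ℕ => 1 / ((n : ℝ) + 1) *
            BSSC.feedbackCapacity (BSSC.bssc α β) ρ n) atTop
          (𝓝 (⨆ p, BSSC.singleLetterInfo (BSSC.bssc α β) b' p))) ∧
        Tendsto (fun n : ℕ => 1 / ((n : ℝ) + 1) *
            BSSC.feedbackCapacity (BSSC.bssc α β) ρ n) atTop (𝓝 C)) := by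
  obtain ⟨hα0, hα1⟩ := id hα
  obtain ⟨hβ0, hβ1⟩ := id hβ
  have hd : α + β - 1 ≠ 0 := sub_ne_zero.2 hαβ
  have hpow : (0 : ℝ) < 2 ^ μ := Real.rpow_pos_of_pos two_pos μ
  have hlam0 : 0 < lam := by rw [hlam]; positivity
  have hlam1 : lam < 1 := by rw [hlam, div_lt_one (by positivity)]; linarith
  -- Equivalently `lam = ν α + (1 - ν)(1 - β)`.
  have hνlam : (α + β - 1) * ν = lam - (1 - β) := by
    rw [hν, hlam]
    field_simp
  -- Since `H(β) = H(1 - β)`, `μ` is a slope of the entropy, and `lam` is a mean value point between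
  -- `α` and `1 - β`; `ν` is its convex weight.
  have hmean : ν ∈ Set.Icc (0 : ℝ) 1 := by
    have hslope : ∀ x y : ℝ, (BSSC.entropy₂ x - BSSC.entropy₂ y) / (x - y)
        = (BSSC.entropy₂ y - BSSC.entropy₂ x) / (y - x) := fun x y => by
      rw [← neg_div_neg_eq, neg_sub, neg_sub]
    have hμ' : μ = (BSSC.entropy₂ (1 - β) - BSSC.entropy₂ α) / ((1 - β) - α) := by
      rw [hμ, BSSC.entropy₂_one_sub]; congr 1; ring
    rcases lt_or_gt_of_ne hαβ with h | h
    · obtain ⟨ξ, ⟨h1, h2⟩, h3⟩ :=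
        BSSC.exists_slope_entropy₂ hα0 (y := 1 - β) (by linarith) (by linarith)
      rw [← hμ', ← hlam] at h3
      constructor <;> nlinarith
    · obtain ⟨ξ, ⟨h1, h2⟩, h3⟩ :=
        BSSC.exists_slope_entropy₂ (x := 1 - β) (y := α) (by linarith) (by linarith) hα1
      rw [hslope, ← hμ', ← hlam] at h3
      constructor <;> nlinarith
  have hlog : Real.logb 2 (1 - lam) = Real.logb 2 lam + μ := by
    have : 1 - lam = lam * 2 ^ μ := by rw [hlam]; field_simp; ring
    rw [this, Real.logb_mul hlam0.ne' hpow.ne', Real.logb_rpow two_pos (by norm_num)]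
  have hμd : BSSC.entropy₂ β - BSSC.entropy₂ α = μ * (1 - α - β) := by
    rw [hμ, div_mul_cancel₀]
    intro h; apply hαβ; linarith
  have hHlam : BSSC.entropy₂ lam =
      -lam * Real.logb 2 lam - (1 - lam) * Real.logb 2 (1 - lam) := by
    have := BSSC.divergence_eq (x := lam) hlam0 hlam1
    rw [div_self hlam0.ne', div_self (by linarith)] at this
    simp only [Real.logb_one, mul_zero, add_zero] at this
    linarith
  -- The two divergences differ by `H(β) - H(α) - μ (1 - α - β) = 0`, and `C` is their mean with
  -- weights `ν`, `1 - ν`.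
  have hDα : -BSSC.entropy₂ α - α * Real.logb 2 lam - (1 - α) * Real.logb 2 (1 - lam) = C := by
    rw [hC, hHlam, hlog]
    linear_combination (1 - ν) * hμd + μ * hνlam
  have hDβ : -BSSC.entropy₂ (1 - β) - (1 - β) * Real.logb 2 lam
      - (1 - (1 - β)) * Real.logb 2 (1 - lam) = C := by
    rw [hC, hHlam, hlog, BSSC.entropy₂_one_sub]
    linear_combination -ν * hμd + μ * hνlam
  let Q : Fin 2 → Fin 2 → ℝ := fun b' b => BSSC.symMatrix lam b b'
  have hQdiag : ∀ b', Q b' b' = lam ∧ Q b' (1 - b') = 1 - lam := by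
    intro b'; fin_cases b' <;> simp [Q, BSSC.symMatrix]
  have hQ : ∀ b' b, 0 < Q b' b := by
    intro b' b
    fin_cases b' <;> fin_cases b <;> simp [Q, BSSC.symMatrix, hlam0, hlam1]
  have hQ1 : ∀ b', ∑ b, Q b' b = 1 := by
    intro b'; fin_cases b' <;> simp [Q, BSSC.symMatrix]
  have hD : ∀ b' a, ∑ b, BSSC.bssc α β b' a b * Real.logb 2 (BSSC.bssc α β b' a b / Q b' b)
      = C := by
    intro b' a
    rw [BSSC.bssc_sum_mul α β b' a fun x b => x * Real.logb 2 (x / Q b' b), (hQdiag b').1,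
      (hQdiag b').2, BSSC.divergence_eq hlam0 hlam1]
    split_ifs
    · exact hDα
    · exact hDβ
  have hW0 := BSSC.bssc_nonneg hα hβ
  have hW := BSSC.bssc_sum α β
  have hdν := BSSC.symMatrix_mem_doublyStochastic hmean.1 hmean.2
  let πTI : Fin 2 → stdSimplex ℝ (Fin 2) := fun b' =>
    ⟨fun a => BSSC.symMatrix ν a b', fun a => nonneg_of_mem_doublyStochastic hdν,
      sum_col_of_mem_doublyStochastic hdν b'⟩
  have hπ : ∀ b' a, πTI b' a = BSSC.symMatrix ν a b' := fun _ _ => rfl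
  have hπdiag : ∀ b', πTI b' b' = ν := by
    intro b'; rw [hπ]; fin_cases b' <;> simp [BSSC.symMatrix]
  have hout : ∀ b' b, BSSC.outputTransition (BSSC.bssc α β) πTI b' b = Q b' b := by
    intro b' b
    rw [BSSC.outputTransition_bssc, hπdiag, hνlam, add_sub_cancel]
  have huniq : ∀ (π : Fin 2 → stdSimplex ℝ (Fin 2)) b',
      (∀ b, BSSC.outputTransition (BSSC.bssc α β) π b' b = Q b' b) ↔ π b' = πTI b' := by
    intro π b'
    constructor
    · intro h
      simp only [BSSC.outputTransition_bssc] at h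
      have h1 := BSSC.symMatrix_injective_col h
      have h2 : π b' b' = πTI b' b' := by
        rw [hπdiag]
        -- Here `α + β ≠ 1` makes the input recoverable from its output transition.
        exact mul_left_cancel₀ hd (by linarith)
      have h3 := stdSimplex.sum_eq_one (π b')
      have h4 := stdSimplex.sum_eq_one (πTI b')
      rw [Fin.sum_univ_two] at h3 h4
      refine stdSimplex.ext (funext fun a => ?_)
      fin_cases b' <;> fin_cases a <;> simp at h2 h3 h4 ⊢ <;> linarith
    · intro h b
      rw [← hout b' b, BSSC.outputTransition_bssc, BSSC.outputTransition_bssc, h]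
  have hsingle : ∀ b', IsGreatest (Set.range (BSSC.singleLetterInfo (BSSC.bssc α β) b')) C ∧
      BSSC.singleLetterInfo (BSSC.bssc α β) b' (πTI b') = C := by
    intro b'
    have h := (BSSC.singleLetterInfo_le hW0 hW hQ hQ1 hD b' (πTI b')).2.2 (hout b')
    refine ⟨⟨⟨_, h⟩, ?_⟩, h⟩
    rintro _ ⟨p, rfl⟩
    exact (BSSC.singleLetterInfo_le hW0 hW hQ hQ1 hD b' p).1
  -- A greatest element makes the real `⨆` a true maximum, not the default value of an unbounded
  -- family.
  have hsup : ∀ b', ⨆ p, BSSC.singleLetterInfo (BSSC.bssc α β) b' p = C :=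
    fun b' => (hsingle b').1.csSup_eq
  have hdir : ∀ (ρ : stdSimplex ℝ (Fin 2)) (n : ℕ), BSSC.directedInfo (BSSC.bssc α β) ρ
      (BSSC.MarkovInput.toFeedback fun _ => πTI) n = (n + 1) * C := fun ρ n =>
    BSSC.directedInfo_eq hW0 hW hQ hQ1 hD ρ (fun _ => πTI) n fun _ => hout
  have hmar : ∀ (ρ : stdSimplex ℝ (Fin 2)) (n : ℕ), BSSC.markovInfo (BSSC.bssc α β) ρ
      (fun _ => πTI) n = (n + 1) * C := fun ρ n =>
    (BSSC.markovInfo_le hW0 hW hQ hQ1 hD ρ (fun _ => πTI) n).2.2 fun _ b' _ => hout b'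
  have hdirG : ∀ (ρ : stdSimplex ℝ (Fin 2)) (n : ℕ), IsGreatest
      (Set.range fun q : BSSC.FeedbackInput (Fin 2) (Fin 2) =>
        BSSC.directedInfo (BSSC.bssc α β) ρ q n) ((n + 1) * C) := by
    refine fun ρ n => ⟨⟨_, hdir ρ n⟩, ?_⟩
    rintro _ ⟨q, rfl⟩
    exact (BSSC.directedInfo_le hW0 hW hQ hQ1 hD ρ q n).1
  have hmarG : ∀ (ρ : stdSimplex ℝ (Fin 2)) (n : ℕ), IsGreatest
      (Set.range fun π : BSSC.MarkovInput (Fin 2) (Fin 2) =>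
        BSSC.markovInfo (BSSC.bssc α β) ρ π n) ((n + 1) * C) := by
    refine fun ρ n => ⟨⟨_, hmar ρ n⟩, ?_⟩
    rintro _ ⟨π, rfl⟩
    exact (BSSC.markovInfo_le hW0 hW hQ hQ1 hD ρ π n).1
  have hfc : ∀ (ρ : stdSimplex ℝ (Fin 2)) (n : ℕ),
      BSSC.feedbackCapacity (BSSC.bssc α β) ρ n = (n + 1) * C := fun ρ n => (hdirG ρ n).csSup_eq
  have hmc : ∀ (ρ : stdSimplex ℝ (Fin 2)) (n : ℕ),
      BSSC.markovCapacity (BSSC.bssc α β) ρ n = (n + 1) * C := fun ρ n => (hmarG ρ n).csSup_eq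
  have hlim : ∀ ρ : stdSimplex ℝ (Fin 2), Tendsto (fun n : ℕ => 1 / ((n : ℝ) + 1) *
      BSSC.feedbackCapacity (BSSC.bssc α β) ρ n) atTop (𝓝 C) := by
    intro ρ
    refine tendsto_const_nhds.congr fun n => ?_
    rw [hfc, ← mul_assoc, one_div, inv_mul_cancel₀ (by positivity), one_mul]
  refine ⟨hdν, BSSC.symMatrix_mem_doublyStochastic hlam0.le hlam1.le, πTI, hπ, hout, hsingle,
    fun ρ n => ⟨?_, ?_, fun π => ?_, ?_, fun b' => ?_, hfc ρ n⟩,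
    fun ρ => ⟨fun b' => ?_, hlim ρ⟩⟩
  · rw [hdir]; exact hdirG ρ n
  · rw [hmar]; exact hmarG ρ n
  · rw [hmc, (BSSC.markovInfo_le hW0 hW hQ hQ1 hD ρ π n).2]
    exact forall_congr' fun i => forall_congr' fun b' => imp_congr_right fun _ => huniq (π i) b'
  · rw [hfc, hmc]
  · rw [hfc, hsup]
  · rw [hsup]; exact hlim ρ
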